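/- For $n\in\mathbb N$ write $[n]$ for a domain of $n$ elements. Let $\log$ be the binary logarithm and $\log^\star n=\min\{k\ge 0:\log^{(k)}n\le 1\}$, where $\log^{(0)}n=n$ and $\log^{(k+1)}n=\log(\log^{(k)}n)$. For distributions $\mu,\mu'$ over $[n]$ let $d(\mu,\mu')=\frac12\sum_{i\in[n]}|\mu(i)-\mu'(i)|$. A conditional sample from $\mu'$ with a nonempty set $A\subseteq[n]$ is an element of $A$ drawn according to $\mu'$ conditioned on $A$ (uniformly from $A$ if $\mu'(A)=0$), independently of all previous draws. An adaptive algorithm using $t$ conditional samples is a randomized algorithm that makes $t$ such draws, where each set may depend on the samples received so far and on the internal coin tosses, and then accepts or rejects on the basis of all the samples and its coin tosses; the measure of complexity is the number $t$ of samples. Theorem. Identity with a known distribution can be tested adaptively with $\mathrm{poly}(\log^\star n,\epsilon^{-1},\log(\delta^{-1}))$ conditional samples. That is, there are a function $t(\epsilon,\delta,n)$ with values in $\mathbb N$, a real polynomial $P$ in three variables, and, for all $\epsilon,\delta>0$, $n$ and every (known) distribution $\mu$ over $[n]$, an adaptive algorithm $T_{\epsilon,\delta,n,\mu}$ using $t(\epsilon,\delta,n)$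 conditional samples from an unknown distribution $\mu'$ over $[n]$, such that 1. if $\mu'=\mu$, then $T_{\epsilon,\delta,n,\mu}$ accepts with probability at least $1-\delta$; 2. if $d(\mu',\mu)\ge\epsilon$, then $T_{\epsilon,\delta,n,\mu}$ rejects with probability at least $1-\delta$; 3. $t(\epsilon,\delta,n)\le P\bigl(\log^\star n,\epsilon^{-1},\log(\delta^{-1})\bigr)$ for all $\epsilon>0$, $0<\delta<1$ and $n$. -/

import Mathlib

/-- The iterated logarithm `log* n = min {k : log^(k) n ≤ 1}`, where `log^(0) n = n`,
`log^(k+1) n = log (log^(k) n)` and `log` is the binary logarithm. -/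
noncomputable def logStar (n : ℕ) : ℕ :=
  sInf {k : ℕ | (Real.logb 2)^[k] (n : ℝ) ≤ 1}

/-- The minimum defining `logStar` is over a nonempty set, so it is attained. -/
theorem logStar_spec (n : ℕ) : (Real.logb 2)^[logStar n] (n : ℝ) ≤ 1 := by
  have step : ∀ x : ℝ, 1 < x → Real.logb 2 x ≤ max 1 (x - 1) := by
    intro x hx
    rcases le_total x 2 with h | h
    · refine le_trans ?_ (le_max_left _ _)
      rw [Real.logb_le_iff_le_rpow (by norm_num) (by linarith)]
      simpa using h
    · refine le_trans ?_ (le_max_right _ _)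
      rw [Real.logb_le_iff_le_rpow (by norm_num) (by linarith)]
      have := one_add_mul_self_le_rpow_one_add (s := 1) (by norm_num) (p := x - 1) (by linarith)
      norm_num at this
      linarith
  have key : ∀ (m : ℕ) (x : ℝ), x ≤ m + 1 → ∃ k : ℕ, (Real.logb 2)^[k] x ≤ 1 := by
    intro m
    induction m with
    | zero => exact fun x hx => ⟨0, by simpa using hx⟩
    | succ m ih =>
      intro x hx
      rcases le_or_gt x 1 with h | h
      · exact ⟨0, h⟩
      · have h2 : Real.logb 2 x ≤ m + 1 := by
          refine (step x h).trans (max_le ?_ ?_)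
          · have : (0 : ℝ) ≤ m := Nat.cast_nonneg m
            linarith
          · push_cast at hx
            linarith
        obtain ⟨k, hk⟩ := ih _ h2
        exact ⟨k + 1, by simpa [Function.iterate_succ_apply] using hk⟩
  exact Nat.sInf_mem (s := {k : ℕ | (Real.logb 2)^[k] (n : ℝ) ≤ 1}) (key n n (by linarith))

/-- The variation distance `d(μ, ν) = 1/2 ∑ i, |μ i - ν i|` of two distributions over `[n]`. -/
noncomputable def variationDist {n : ℕ} (μ ν : PMF (Fin n)) : ℝ :=
  (1 / 2) * ∑ i, |(μ i).toReal - (ν i).toReal|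

/-- `μ` is `ε`-far from the property `S` of distributions over `[n]`: it has variation distance
at least `ε` from every distribution that satisfies `S`. -/
def IsFar {n : ℕ} (ε : ℝ) (μ : PMF (Fin n)) (S : Set (PMF (Fin n))) : Prop :=
  ∀ ν ∈ S, ε ≤ variationDist μ ν

open Classical in
/-- The law of one call, with the nonempty set `A`, to the conditional sampling oracle of `μ`:
the distribution `μ` conditioned on `A`, or the uniform distribution on `A` when `μ(A) = 0`. -/
noncomputable def condSample {n : ℕ} (μ : PMF (Fin n)) (A : Finset (Fin n)) (hA : A.Nonempty) :
    PMF (Fin n) :=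
  if h : ∑ i ∈ A, μ i = 0 then PMF.uniformOfFinset A hA
  else μ.filter (A : Set (Fin n)) (by
    obtain ⟨i, hi, h0⟩ := Finset.exists_ne_zero_of_sum_ne_zero h
    exact ⟨i, hi, (μ.mem_support_iff i).2 h0⟩)

/-- Randomized adaptive algorithms over the domain `[n]` that make exactly `t` calls to a
conditional sampling oracle and then accept (`true`) or reject (`false`). They are given as
computation trees: whatever an algorithm does next may depend on all the samples received and all
the internal coins tossed so far. -/
inductive CondAlgorithm (n : ℕ) : ℕ → Type
  /-- Stop, and accept or reject. -/
  | answer (b : Bool) : CondAlgorithm n 0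
  /-- Toss an internal coin with the `k + 1` equally likely outcomes `0, …, k`, and continue
  according to the outcome. -/
  | toss {t : ℕ} (k : ℕ) (next : Fin (k + 1) → CondAlgorithm n t) : CondAlgorithm n t
  /-- Call the oracle with the nonempty set `A`, and continue according to the sample received. -/
  | query {t : ℕ} (A : Finset (Fin n)) (hA : A.Nonempty) (next : Fin n → CondAlgorithm n t) :
      CondAlgorithm n (t + 1)

/-- The law of the output of an algorithm whose oracle samples from `μ`; all oracle samples and all
coin tosses are independent. -/
noncomputable def CondAlgorithm.output {n : ℕ} (μ : PMF (Fin n)) :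
    {t : ℕ} → CondAlgorithm n t → PMF Bool
  | _, .answer b => PMF.pure b
  | _, .toss k next => (PMF.uniformOfFintype (Fin (k + 1))).bind fun c => (next c).output μ
  | _, .query A hA next => (condSample μ A hA).bind fun j => (next j).output μ

/-- The algorithm `T` tests the property `S` of distributions over `[n]` with distance parameter
`ε` and error bound `δ`: it accepts every distribution that satisfies `S` with probability at least
`1 - δ`, and rejects every distribution that is `ε`-far from `S` with probability at least
`1 - δ`. -/
def CondAlgorithm.Tests {n t : ℕ} (T : CondAlgorithm n t) (S : Set (PMF (Fin n)))
    (ε δ : ℝ) : Prop :=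
  (∀ μ ∈ S, 1 - δ ≤ (T.output μ true).toReal) ∧
    ∀ μ, IsFar ε μ S → 1 - δ ≤ (T.output μ false).toReal

/-! ### Finite sums: splitting into blocks, sampling, and the chain rule -/

section FiniteSums

variable {ι : Type*}

theorem exists_subset_sum_mem_Icc [DecidableEq ι] (f : ι → ℝ) {w : ℝ} (G : Finset ι)
    (hf : ∀ i ∈ G, f i ≤ w)
    (hw : 0 < w) (hG : w ≤ ∑ i ∈ G, f i) :
    ∃ S ⊆ G, w ≤ ∑ i ∈ S, f i ∧ ∑ i ∈ S, f i ≤ 2 * w := by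
  induction G using Finset.induction_on with
  | empty => simp at hG; linarith
  | insert a G ha ih =>
    by_cases h : w ≤ ∑ i ∈ G, f i
    · obtain ⟨S, hS, h1⟩ := ih (fun i hi => hf i (Finset.mem_insert_of_mem hi)) h
      exact ⟨S, hS.trans (Finset.subset_insert _ _), h1⟩
    · refine ⟨_, subset_rfl, hG, ?_⟩
      rw [Finset.sum_insert ha]
      linarith [hf a (Finset.mem_insert_self _ _)]

/-- A set of total weight at least `w`, all of whose elements weigh at most `w`, can be coloured so
that every colour class has weight between `w` and `3 * w`. -/
theorem exists_coloring_sum_mem_Icc [DecidableEq ι] (f : ι → ℝ) {w : ℝ} (hw : 0 < w) (G : Finset ι)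
    (hf : ∀ i ∈ G, f i ≤ w) (hG : w ≤ ∑ i ∈ G, f i) :
    ∃ c : ι → ℕ, ∀ j ∈ G, w ≤ ∑ k ∈ G with c k = c j, f k ∧
      ∑ k ∈ G with c k = c j, f k ≤ 3 * w := by
  induction G using Finset.strongInduction with
  | H G ih =>
    by_cases h : ∑ i ∈ G, f i ≤ 3 * w
    · exact ⟨fun _ => 0, fun j _ => by simpa using ⟨hG, h⟩⟩
    · obtain ⟨S, hS, h1, h2⟩ := exists_subset_sum_mem_Icc f G hf hw hG
      have hne : S.Nonempty := by
        rw [Finset.nonempty_iff_ne_empty]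
        rintro rfl
        simp at h1
        linarith
      have hsum := Finset.sum_sdiff (f := f) hS
      obtain ⟨c, hc⟩ := ih (G \ S) (Finset.sdiff_ssubset hS hne)
        (fun i hi => hf i (Finset.mem_sdiff.1 hi).1) (by linarith)
      refine ⟨fun k => if k ∈ S then 0 else c k + 1, fun j hj => ?_⟩
      by_cases hjS : j ∈ S
      · have : {k ∈ G | (if k ∈ S then 0 else c k + 1) = if j ∈ S then 0 else c j + 1} = S := by
          ext k
          simp only [Finset.mem_filter, hjS, if_true]
          constructor
          · rintro ⟨-, h⟩
            by_contra hk
            simp [hk] at h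
          · exact fun hk => ⟨hS hk, by simp [hk]⟩
        rw [this]
        exact ⟨h1, by linarith⟩
      · have : {k ∈ G | (if k ∈ S then 0 else c k + 1) = if j ∈ S then 0 else c j + 1} =
            {k ∈ G \ S | c k = c j} := by
          ext k
          by_cases hk : k ∈ S <;> simp [hjS, hk]
        rw [this]
        exact hc j (Finset.mem_sdiff.2 ⟨hj, hjS⟩)

/-- The colour classes whose `f`-weight is not small compared with their `g`-weight carry a
nontrivial part of the `f`-weight. -/
theorem mul_sum_le_sum_filter_color (f g : ι → ℝ) (hf : ∀ i, 0 ≤ f i) (hg : ∀ i, 0 ≤ g i)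
    (G : Finset ι) (c : ι → ℕ) {θ : ℝ} (hθ : θ ≤ 1) (hG : 0 < ∑ i ∈ G, g i) :
    θ * ∑ i ∈ G, f i ≤ ∑ j ∈ G with (1 - θ) * (∑ i ∈ G, f i) * (∑ k ∈ G with c k = c j, g k) ≤
      (∑ k ∈ G with c k = c j, f k) * ∑ i ∈ G, g i, f j := by
  classical
  set P : ι → Prop := fun j => (1 - θ) * (∑ i ∈ G, f i) * (∑ k ∈ G with c k = c j, g k) ≤
      (∑ k ∈ G with c k = c j, f k) * ∑ i ∈ G, g i with hP
  have hsplit := Finset.sum_filter_add_sum_filter_not G P f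
  set B := G.filter (fun j => ¬ P j) with hB
  have hfib : ∀ u : ι → ℝ, ∑ b ∈ B.image c, ∑ k ∈ G with c k = b, u k = ∑ j ∈ B, u j := by
    intro u
    rw [← Finset.sum_fiberwise_of_maps_to (s := B) (t := B.image c) (g := c)
      (fun i hi => Finset.mem_image_of_mem c hi)]
    refine Finset.sum_congr rfl fun b hb => ?_
    obtain ⟨j, hj, rfl⟩ := Finset.mem_image.1 hb
    refine Finset.sum_congr ?_ fun _ _ => rfl
    ext k
    simp only [Finset.mem_filter, hB, hP]
    constructor
    · rintro ⟨hk, hkj⟩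
      refine ⟨⟨hk, ?_⟩, hkj⟩
      rw [hkj]
      exact (Finset.mem_filter.1 hj).2
    · rintro ⟨⟨hk, -⟩, hkj⟩
      exact ⟨hk, hkj⟩
  have hf0 : 0 ≤ ∑ i ∈ G, f i := Finset.sum_nonneg fun i _ => hf i
  have hle : (∑ j ∈ B, f j) * ∑ i ∈ G, g i ≤ (1 - θ) * (∑ i ∈ G, f i) * ∑ j ∈ B, g j := by
    rw [← hfib f, ← hfib g, Finset.sum_mul, Finset.mul_sum]
    refine Finset.sum_le_sum fun b hb => ?_
    obtain ⟨j, hj, rfl⟩ := Finset.mem_image.1 hb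
    exact (not_le.1 (Finset.mem_filter.1 hj).2).le
  have hBG : ∑ j ∈ B, g j ≤ ∑ i ∈ G, g i :=
    Finset.sum_le_sum_of_subset_of_nonneg (Finset.filter_subset _ _) fun i _ _ => hg i
  have : ∑ j ∈ B, f j ≤ (1 - θ) * ∑ i ∈ G, f i := by
    refine le_of_mul_le_mul_right (hle.trans ?_) hG
    exact mul_le_mul_of_nonneg_left hBG (mul_nonneg (by linarith) hf0)
  linarith

/-- Any weights can be sampled, up to a factor of two, with a uniform finite coin. -/
theorem exists_sampler [Fintype ι] [Nonempty ι] (w : ι → ℝ) (hw : ∀ i, 0 ≤ w i) :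
    ∃ (k : ℕ) (s : Fin (k + 1) → ι), ∀ F : ι → ℝ, (∀ i, 0 ≤ F i) →
      ∑ i, w i * F i ≤ 2 * (∑ i, w i) * (((k : ℝ) + 1)⁻¹ * ∑ c, F (s c)) := by
  have hW0 : 0 ≤ ∑ i, w i := Finset.sum_nonneg fun i _ => hw i
  rcases hW0.eq_or_lt with hW | hW
  · refine ⟨0, fun _ => Classical.arbitrary ι, fun F _ => ?_⟩
    have h0 : ∀ i, w i = 0 := fun i =>
      (Finset.sum_eq_zero_iff_of_nonneg fun i _ => hw i).1 hW.symm i (Finset.mem_univ i)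
    simp [h0]
  set W := ∑ i, w i
  set n : ℝ := (Fintype.card ι : ℝ) with hn
  have hn0 : 0 < n := by rw [hn]; exact_mod_cast Fintype.card_pos
  set m : ι → ℕ := fun i => ⌈n * w i / W⌉₊ with hm
  have hlow : ∀ i, n * w i / W ≤ m i := fun i => Nat.le_ceil _
  have hup : ∀ i, (m i : ℝ) ≤ n * w i / W + 1 := fun i =>
    (Nat.ceil_lt_add_one (div_nonneg (mul_nonneg hn0.le (hw i)) hW.le)).le
  have hsumw : ∑ i, n * w i / W = n := by
    rw [← Finset.sum_div, ← Finset.mul_sum, mul_div_assoc, div_self hW.ne', mul_one]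
  have hcard : (Fintype.card (Σ i, Fin (m i)) : ℝ) = ∑ i, (m i : ℝ) := by simp
  have hge : n ≤ ∑ i, (m i : ℝ) := by
    rw [← hsumw]
    exact Finset.sum_le_sum fun i _ => hlow i
  have hle : ∑ i, (m i : ℝ) ≤ 2 * n := by
    refine (Finset.sum_le_sum fun i _ => hup i).trans ?_
    rw [Finset.sum_add_distrib, hsumw]
    simp [hn, two_mul]
  have hpos : 0 < Fintype.card (Σ i, Fin (m i)) := by
    have : (0 : ℝ) < Fintype.card (Σ i, Fin (m i)) := by rw [hcard]; linarith
    exact_mod_cast this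
  obtain ⟨k, hk⟩ := Nat.exists_eq_succ_of_ne_zero hpos.ne'
  let e : Fin (k + 1) ≃ Σ i, Fin (m i) := (Fintype.equivFinOfCardEq hk).symm
  refine ⟨k, fun c => (e c).1, fun F hF => ?_⟩
  have hsum : ∑ c, F (e c).1 = ∑ i, (m i : ℝ) * F i := by
    rw [e.sum_comp (fun x => F x.1), Fintype.sum_sigma]
    simp
  have hk1 : (k : ℝ) + 1 = ∑ i, (m i : ℝ) := by
    rw [← hcard, hk]
    push_cast
    ring
  rw [hsum, hk1]
  have hmF : ∑ i, (n / W) * (w i * F i) ≤ ∑ i, (m i : ℝ) * F i := by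
    refine Finset.sum_le_sum fun i _ => ?_
    calc (n / W) * (w i * F i) = n * w i / W * F i := by ring
      _ ≤ _ := mul_le_mul_of_nonneg_right (hlow i) (hF i)
  rw [← Finset.mul_sum] at hmF
  have hwF : 0 ≤ ∑ i, w i * F i := Finset.sum_nonneg fun i _ => mul_nonneg (hw i) (hF i)
  have hM : 0 < ∑ i, (m i : ℝ) := by linarith
  rw [inv_mul_eq_div, mul_div_assoc', le_div_iff₀ hM]
  calc (∑ i, w i * F i) * ∑ i, (m i : ℝ) ≤ (∑ i, w i * F i) * (2 * n) :=
        mul_le_mul_of_nonneg_left hle hwF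
    _ = 2 * W * (n / W * ∑ i, w i * F i) := by field_simp
    _ ≤ _ := mul_le_mul_of_nonneg_left hmF (by positivity)

end FiniteSums

section ChainRule

variable {ι : Type*}

/-- The elements up to `i` when the domain is sorted by increasing weight. -/
noncomputable def lightSet [Fintype ι] [LinearOrder ι] (f : ι → ℝ) (i : ι) : Finset ι :=
  {j | toLex (f j, j) ≤ toLex (f i, i)}

theorem self_mem_lightSet [Fintype ι] [LinearOrder ι] (f : ι → ℝ) (i : ι) : i ∈ lightSet f i := by
  simp [lightSet]

theorem lightSet_nonempty [Fintype ι] [LinearOrder ι] (f : ι → ℝ) (i : ι) :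
    (lightSet f i).Nonempty :=
  ⟨i, self_mem_lightSet f i⟩

theorem le_of_mem_lightSet [Fintype ι] [LinearOrder ι] {f : ι → ℝ} {i j : ι}
    (h : j ∈ lightSet f i) : f j ≤ f i := by
  simp only [lightSet, Finset.mem_filter, Finset.mem_univ, true_and, Prod.Lex.toLex_le_toLex] at h
  rcases h with h | h
  · exact h.le
  · exact h.1.le

/-- The contribution of an element to the distance between `f` and `g`, if it is compared with the
set `G`. -/
noncomputable def hazardGap (f g : ι → ℝ) (G : Finset ι) (i : ι) : ℝ :=
  min (∑ j ∈ G, f j) (∑ j ∈ G, g j) * |f i / ∑ j ∈ G, f j - g i / ∑ j ∈ G, g j|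

theorem abs_sub_le_of_hazard {h h' q q' : ℝ} (hq : 0 ≤ q) (hq' : 0 ≤ q') (h1 : h ≤ 1)
    (h1' : h' ≤ 1) :
    |(1 - h) * q - (1 - h') * q'| ≤
      min (1 - h) (1 - h') * |q - q'| + |h - h'| * (if h' ≤ h then q' else q) := by
  split_ifs with hh
  · rw [min_eq_left (by linarith), abs_of_nonneg (sub_nonneg.2 hh)]
    have : (1 - h) * q - (1 - h') * q' = (1 - h) * (q - q') - (h - h') * q' := by ring
    rw [this]
    refine (abs_sub _ _).trans ?_
    rw [abs_mul, abs_mul, abs_of_nonneg (sub_nonneg.2 h1), abs_of_nonneg (sub_nonneg.2 hh),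
      abs_of_nonneg hq']
  · push Not at hh
    rw [min_eq_right (by linarith), abs_of_nonpos (by linarith : h - h' ≤ 0)]
    have : (1 - h) * q - (1 - h') * q' = (1 - h') * (q - q') + (h' - h) * q := by ring
    rw [this]
    refine (abs_add_le _ _).trans ?_
    rw [abs_mul, abs_mul, abs_of_nonneg (sub_nonneg.2 h1'),
      abs_of_nonneg (by linarith : 0 ≤ h' - h),      abs_of_nonneg hq, neg_sub]

/-- One step of the chain rule for the variation distance. -/
theorem min_mul_sum_abs_insert_le [DecidableEq ι] (f g : ι → ℝ)
    (hf : ∀ i, 0 ≤ f i) (hg : ∀ i, 0 ≤ g i) {S : Finset ι} {a : ι} (ha : a ∉ S) :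
    min (∑ i ∈ insert a S, f i) (∑ i ∈ insert a S, g i) *
        ∑ i ∈ insert a S, |f i / ∑ j ∈ insert a S, f j - g i / ∑ j ∈ insert a S, g j| ≤
      2 * hazardGap f g (insert a S) a +
        min (∑ i ∈ S, f i) (∑ i ∈ S, g i) * ∑ i ∈ S, |f i / ∑ j ∈ S, f j - g i / ∑ j ∈ S, g j| := by
  have hf0 : 0 ≤ ∑ i ∈ S, f i := Finset.sum_nonneg fun i _ => hf i
  have hg0 : 0 ≤ ∑ i ∈ S, g i := Finset.sum_nonneg fun i _ => hg i
  have hqle : ∀ u : ι → ℝ, (∀ i, 0 ≤ u i) → ∑ i ∈ S, u i / ∑ j ∈ S, u j ≤ 1 := fun u hu => by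
    rw [← Finset.sum_div]
    exact div_self_le_one _
  have hq : ∀ u : ι → ℝ, (∀ i, 0 ≤ u i) → 0 < ∑ j ∈ insert a S, u j → ∀ i ∈ S,
      u i / ∑ j ∈ insert a S, u j =
        (1 - u a / ∑ j ∈ insert a S, u j) * (u i / ∑ j ∈ S, u j) := by
    intro u hu hpos i hi
    rcases (Finset.sum_nonneg fun i _ => hu i : 0 ≤ ∑ j ∈ S, u j).eq_or_lt with h0 | h0
    · rw [(Finset.sum_eq_zero_iff_of_nonneg fun i _ => hu i).1 h0.symm i hi]
      simp
    · rw [Finset.sum_insert ha] at hpos ⊢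
      field_simp
      ring
  set m := ∑ j ∈ insert a S, f j with hm
  set m' := ∑ j ∈ insert a S, g j with hm'
  set m₀ := ∑ j ∈ S, f j with hm₀
  set m₀' := ∑ j ∈ S, g j with hm₀'
  have hmm : m = f a + m₀ := Finset.sum_insert ha
  have hmm' : m' = g a + m₀' := Finset.sum_insert ha
  have hRHS : 0 ≤ 2 * hazardGap f g (insert a S) a + min m₀ m₀' *
      ∑ i ∈ S, |f i / m₀ - g i / m₀'| := by
    have h1 : 0 ≤ hazardGap f g (insert a S) a :=
      mul_nonneg (le_min (Finset.sum_nonneg fun i _ => hf i) (Finset.sum_nonneg fun i _ => hg i))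
        (abs_nonneg _)
    have h2 : 0 ≤ ∑ i ∈ S, |f i / m₀ - g i / m₀'| := Finset.sum_nonneg fun i _ => abs_nonneg _
    have h3 : 0 ≤ min m₀ m₀' := le_min hf0 hg0
    positivity
  by_cases hpos : 0 < min m m'
  swap
  · have : min m m' = 0 := le_antisymm (not_lt.1 hpos)
      (le_min (Finset.sum_nonneg fun i _ => hf i) (Finset.sum_nonneg fun i _ => hg i))
    rw [this, zero_mul]
    exact hRHS
  obtain ⟨hmpos, hmpos'⟩ := lt_min_iff.1 hpos
  set h := f a / m with hh
  set h' := g a / m' with hh'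
  have h1 : h ≤ 1 := (div_le_one hmpos).2 (by linarith)
  have h1' : h' ≤ 1 := (div_le_one hmpos').2 (by linarith)
  have hbound : ∑ i ∈ S, |f i / m - g i / m'| ≤
      min (1 - h) (1 - h') * ∑ i ∈ S, |f i / m₀ - g i / m₀'| + |h - h'| := by
    have : ∑ i ∈ S, |f i / m - g i / m'| ≤ ∑ i ∈ S, (min (1 - h) (1 - h') *
        |f i / m₀ - g i / m₀'| + |h - h'| * (if h' ≤ h then g i / m₀' else f i / m₀)) := by
      refine Finset.sum_le_sum fun i hi => ?_
      rw [hq f hf hmpos i hi, hq g hg hmpos' i hi]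
      exact abs_sub_le_of_hazard (div_nonneg (hf i) hf0) (div_nonneg (hg i) hg0) h1 h1'
    refine this.trans ?_
    rw [Finset.sum_add_distrib, ← Finset.mul_sum, ← Finset.mul_sum]
    gcongr
    refine mul_le_of_le_one_right (abs_nonneg _) ?_
    split_ifs
    · exact hqle g hg
    · exact hqle f hf
  have hmin : min m m' * min (1 - h) (1 - h') ≤ min m₀ m₀' := by
    have e1 : m * (1 - h) = m₀ := by rw [hh]; field_simp; linarith
    have e2 : m' * (1 - h') = m₀' := by rw [hh']; field_simp; linarith
    refine le_min ?_ ?_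
    · rw [← e1]
      exact mul_le_mul (min_le_left _ _) (min_le_left _ _) (le_min (by linarith) (by linarith))
        hmpos.le
    · rw [← e2]
      exact mul_le_mul (min_le_right _ _) (min_le_right _ _) (le_min (by linarith) (by linarith))
        hmpos'.le
  have hS0 : 0 ≤ ∑ i ∈ S, |f i / m₀ - g i / m₀'| := Finset.sum_nonneg fun i _ => abs_nonneg _
  rw [Finset.sum_insert ha]
  calc min m m' * (|h - h'| + ∑ i ∈ S, |f i / m - g i / m'|)
      ≤ min m m' * (|h - h'| +
          (min (1 - h) (1 - h') * ∑ i ∈ S, |f i / m₀ - g i / m₀'| + |h - h'|)) := by gcongr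
    _ = 2 * (min m m' * |h - h'|) +
          (min m m' * min (1 - h) (1 - h')) * ∑ i ∈ S, |f i / m₀ - g i / m₀'| := by ring
    _ ≤ _ := by
        refine add_le_add (le_of_eq ?_) (mul_le_mul_of_nonneg_right hmin hS0)
        rfl

theorem min_mul_sum_abs_le_sum_hazardGap [Fintype ι] [LinearOrder ι] (f g : ι → ℝ)
    (hf : ∀ i, 0 ≤ f i) (hg : ∀ i, 0 ≤ g i)
    (S : Finset ι) :
    min (∑ i ∈ S, f i) (∑ i ∈ S, g i) * ∑ i ∈ S, |f i / ∑ j ∈ S, f j - g i / ∑ j ∈ S, g j| ≤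
      2 * ∑ i ∈ S, hazardGap f g (S ∩ lightSet f i) i := by
  induction S using Finset.induction_on_max_value (fun i => toLex (f i, i)) with
  | empty => simp
  | insert a S ha hmax ih =>
    refine (min_mul_sum_abs_insert_le f g hf hg ha).trans ?_
    rw [Finset.sum_insert ha, mul_add]
    have e1 : insert a S ∩ lightSet f a = insert a S := by
      refine Finset.inter_eq_left.2 fun i hi => ?_
      simp only [lightSet, Finset.mem_filter, Finset.mem_univ, true_and]
      rcases Finset.mem_insert.1 hi with rfl | hi
      · exact le_rfl
      · exact hmax i hi
    rw [e1]
    refine add_le_add_right (ih.trans (le_of_eq ?_)) _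
    congr 1
    refine Finset.sum_congr rfl fun i hi => ?_
    rw [Finset.insert_inter_of_notMem]
    simp only [lightSet, Finset.mem_filter, Finset.mem_univ, true_and, not_le]
    refine lt_of_le_of_ne (hmax i hi) fun h => ha ?_
    have : i = a := congrArg Prod.snd (toLex.injective h)
    exact this ▸ hi

theorem hazardGap_le (f g : ι → ℝ) (hf : ∀ i, 0 ≤ f i) (hg : ∀ i, 0 ≤ g i) {η : ℝ} (hη : 0 ≤ η)
    (G : Finset ι) (i : ι) :
    hazardGap f g G i ≤ η * (f i + g i) +
      ((if 0 < ∑ j ∈ G, g j ∧ g i * ∑ j ∈ G, f j ≤ (1 - η) * (f i * ∑ j ∈ G, g j) then f i else 0) +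
      if f i * ∑ j ∈ G, g j ≤ (1 - η) * (g i * ∑ j ∈ G, f j) then g i else 0) := by
  have hm : 0 ≤ ∑ j ∈ G, f j := Finset.sum_nonneg fun i _ => hf i
  have hm' : 0 ≤ ∑ j ∈ G, g j := Finset.sum_nonneg fun i _ => hg i
  unfold hazardGap
  have hfi := hf i
  have hgi := hg i
  generalize f i = a at *
  generalize g i = a' at *
  generalize ∑ j ∈ G, f j = m at *
  generalize ∑ j ∈ G, g j = m' at *
  have hA : 0 ≤ if 0 < m' ∧ a' * m ≤ (1 - η) * (a * m') then a else 0 := by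
    split_ifs <;> simp [hfi]
  have hB : 0 ≤ if a * m' ≤ (1 - η) * (a' * m) then a' else 0 := by
    split_ifs <;> simp [hgi]
  have hη' : 0 ≤ η * (a + a') := by positivity
  by_cases hpos : 0 < min m m'
  swap
  · have : min m m' = 0 := le_antisymm (not_lt.1 hpos) (le_min hm hm')
    rw [this, zero_mul]
    positivity
  obtain ⟨hmp, hmp'⟩ := lt_min_iff.1 hpos
  rcases le_total (a' / m') (a / m) with hle | hle
  · have hcost : min m m' * |a / m - a' / m'| ≤ a - m * (a' / m') := by
      rw [abs_of_nonneg (sub_nonneg.2 hle)]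
      calc _ ≤ m * (a / m - a' / m') :=
            mul_le_mul_of_nonneg_right (min_le_left _ _) (sub_nonneg.2 hle)
        _ = _ := by field_simp
    have hnn : 0 ≤ m * (a' / m') := by positivity
    by_cases hgood : a' * m ≤ (1 - η) * (a * m')
    · rw [if_pos ⟨hmp', hgood⟩]
      linarith
    · have : (1 - η) * a ≤ m * (a' / m') := by
        rw [mul_div_assoc', le_div_iff₀ hmp']
        linarith
      nlinarith [mul_nonneg hη hgi]
  · have hcost : min m m' * |a / m - a' / m'| ≤ a' - m' * (a / m) := by
      rw [abs_of_nonpos (sub_nonpos.2 hle), neg_sub]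
      calc _ ≤ m' * (a' / m' - a / m) :=
            mul_le_mul_of_nonneg_right (min_le_right _ _) (sub_nonneg.2 hle)
        _ = _ := by field_simp
    have hnn : 0 ≤ m' * (a / m) := by positivity
    by_cases hgood : a * m' ≤ (1 - η) * (a' * m)
    · rw [if_pos hgood]
      linarith
    · have : (1 - η) * a' ≤ m' * (a / m) := by
        rw [mul_div_assoc', le_div_iff₀ hmp]
        linarith
      nlinarith [mul_nonneg hη hfi]

/-- If two distributions are far apart, then the probability that they give to an element `i`
relative to `lightSet f i` differs noticeably for a noticeable fraction of the elements. -/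
theorem le_sum_hazard_differs [Fintype ι] [LinearOrder ι] (f g : ι → ℝ)
    (hf : ∀ i, 0 ≤ f i) (hg : ∀ i, 0 ≤ g i)
    (hf1 : ∑ i, f i = 1) (hg1 : ∑ i, g i = 1) {ε η : ℝ} (hη : 0 ≤ η)
    (hfar : ε ≤ 1 / 2 * ∑ i, |f i - g i|) :
    ε - 2 * η ≤
      (∑ i, if 0 < ∑ j ∈ lightSet f i, g j ∧
        g i * ∑ j ∈ lightSet f i, f j ≤ (1 - η) * (f i * ∑ j ∈ lightSet f i, g j)
        then f i else 0) +
      ∑ i, if f i * ∑ j ∈ lightSet f i, g j ≤ (1 - η) * (g i * ∑ j ∈ lightSet f i, f j)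
        then g i else 0 := by
  have h := min_mul_sum_abs_le_sum_hazardGap f g hf hg Finset.univ
  simp only [hf1, hg1, min_self, one_mul, div_one, Finset.univ_inter] at h
  have h2 : ∑ i, hazardGap f g (lightSet f i) i ≤ _ :=
    Finset.sum_le_sum fun i _ => hazardGap_le f g hf hg hη (lightSet f i) i
  rw [Finset.sum_add_distrib, Finset.sum_add_distrib, ← Finset.mul_sum, Finset.sum_add_distrib,
    hf1, hg1] at h2
  linarith

end ChainRule

/-! ### Expectations over finite distributions -/

section Expect

variable {α : Type*} [Fintype α]

/-- The expectation of a real function under a distribution on a finite type. -/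
noncomputable def expect (p : PMF α) (F : α → ℝ) : ℝ := ∑ a, (p a).toReal * F a

theorem sum_toReal_eq_one (p : PMF α) : ∑ a, (p a).toReal = 1 := by
  rw [← ENNReal.toReal_sum fun a _ => p.apply_ne_top a, ← tsum_fintype (L := .unconditional α),
    p.tsum_coe, ENNReal.toReal_one]

theorem expect_mono (p : PMF α) {F H : α → ℝ} (h : ∀ a, F a ≤ H a) : expect p F ≤ expect p H :=
  Finset.sum_le_sum fun a _ => mul_le_mul_of_nonneg_left (h a) ENNReal.toReal_nonneg

theorem expect_nonneg (p : PMF α) {F : α → ℝ} (h : ∀ a, 0 ≤ F a) : 0 ≤ expect p F :=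
  Finset.sum_nonneg fun a _ => mul_nonneg ENNReal.toReal_nonneg (h a)

theorem expect_affine (p : PMF α) (a b : ℝ) (F : α → ℝ) :
    expect p (fun x => a + b * F x) = a + b * expect p F := by
  simp only [expect, mul_add, Finset.sum_add_distrib, ← Finset.sum_mul, sum_toReal_eq_one, one_mul,
    Finset.mul_sum]
  congr 1
  exact Finset.sum_congr rfl fun x _ => by ring

theorem expect_le_affine (p : PMF α) {a b : ℝ} {F H : α → ℝ} (h : ∀ x, F x ≤ a + b * H x) :
    expect p F ≤ a + b * expect p H :=
  (expect_mono p h).trans (expect_affine p a b H).le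

theorem toReal_bind_apply {β : Type*} (p : PMF α) (q : α → PMF β) (b : β) :
    ((p.bind q) b).toReal = expect p fun a => (q a b).toReal := by
  rw [PMF.bind_apply, tsum_fintype,
    ENNReal.toReal_sum fun a _ => ENNReal.mul_ne_top (p.apply_ne_top a) ((q a).apply_ne_top b)]
  simp [expect]

theorem expect_uniformOfFintype [Nonempty α] (F : α → ℝ) :
    expect (PMF.uniformOfFintype α) F = (Fintype.card α : ℝ)⁻¹ * ∑ a, F a := by
  simp [expect, Finset.mul_sum]

theorem expect_sub_mul_sub [DecidableEq α] (p : PMF α) (i : α) (r : ℝ) :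
    (expect p fun x => expect p fun y => ((if x = i then 1 else 0) - r) *
      ((if y = i then 1 else 0) - r)) = ((p i).toReal - r) ^ 2 := by
  have h : (expect p fun x => (if x = i then 1 else 0) - r) = (p i).toReal - r := by
    simp only [expect, mul_sub, Finset.sum_sub_distrib, ← Finset.sum_mul, sum_toReal_eq_one]
    simp
  have h2 : ∀ c : ℝ, (expect p fun y => c * ((if y = i then 1 else 0) - r)) =
      c * ((p i).toReal - r) := fun c => by
    have := expect_affine p 0 c fun y => (if y = i then 1 else 0) - r
    simp only [zero_add, h] at this
    exact this
  simp only [h2]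
  have := expect_affine p 0 ((p i).toReal - r) fun y => (if y = i then 1 else 0) - r
  simp only [zero_add, h] at this
  rw [sq, ← this]
  congr 1
  funext x
  ring

end Expect

theorem condSample_apply_toReal {n : ℕ} (D : PMF (Fin n)) {A : Finset (Fin n)} (hA : A.Nonempty)
    (hpos : 0 < ∑ k ∈ A, (D k).toReal) {i : Fin n} (hi : i ∈ A) :
    (condSample D A hA i).toReal = (D i).toReal / ∑ k ∈ A, (D k).toReal := by
  have hs : ∑ k ∈ A, (D k).toReal = (∑ k ∈ A, D k).toReal :=
    (ENNReal.toReal_sum fun k _ => D.apply_ne_top k).symm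
  have h0 : ∑ k ∈ A, D k ≠ 0 := fun h => by
    rw [hs, h] at hpos
    simp at hpos
  have hind : ∑ a, (A : Set (Fin n)).indicator D a = ∑ k ∈ A, D k := by
    rw [← Finset.sum_indicator_subset _ (Finset.subset_univ A)]
  rw [condSample, dif_neg h0, PMF.filter_apply, tsum_fintype, hind, ENNReal.toReal_mul,
    Set.indicator_of_mem (by simpa using hi), ENNReal.toReal_inv, hs, div_eq_mul_inv]

/-! ### The tester -/

namespace IdentityTester

variable {n : ℕ} (f : Fin n → ℝ)

/-- A colouring of `lightSet f i` by classes that weigh roughly as much as `i`. -/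
noncomputable def color (i : Fin n) : Fin n → ℕ :=
  Classical.epsilon fun c : Fin n → ℕ => ∀ j ∈ lightSet f i,
    f i ≤ ∑ k ∈ lightSet f i with c k = c j, f k ∧
      ∑ k ∈ lightSet f i with c k = c j, f k ≤ 3 * f i

/-- The elements of `lightSet f i` with the colour of `j`. -/
noncomputable def block (i j : Fin n) : Finset (Fin n) :=
  {k ∈ lightSet f i | color f i k = color f i j}

/-- The weight of `i` relative to `insert i (block f i j)`. -/
noncomputable def share (i j : Fin n) : ℝ := f i / ∑ k ∈ insert i (block f i j), f k

/-- The score of a round in which the pair `i, j` was drawn and `insert i (block f i j)` was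
sampled with the results `x` and `y`. Its mean is the square of the deviation of the probability of
`i` from `share f i j`, or `v` when `f i = 0`. -/
noncomputable def score (v : ℝ) (i j x y : Fin n) : ℝ :=
  if f i = 0 then v else
    ((if x = i then 1 else 0) - share f i j) * ((if y = i then 1 else 0) - share f i j)

/-- The mean of `score` over the samples `x` and `y`. -/
noncomputable def meanScore (D : PMF (Fin n)) (v : ℝ) (i j : Fin n) : ℝ :=
  if f i = 0 then v else
    ((condSample D (insert i (block f i j)) (Finset.insert_nonempty _ _) i).toReal -
      share f i j) ^ 2

variable {f}

theorem share_mem_Icc (hf : ∀ i, 0 ≤ f i) (i j : Fin n) : share f i j ∈ Set.Icc (0 : ℝ) 1 := by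
  have h0 : 0 ≤ ∑ k ∈ insert i (block f i j), f k := Finset.sum_nonneg fun k _ => hf k
  refine ⟨div_nonneg (hf i) h0, div_le_one_of_le₀ ?_ h0⟩
  exact Finset.single_le_sum (fun k _ => hf k) (Finset.mem_insert_self _ _)

theorem abs_score_le_one (hf : ∀ i, 0 ≤ f i) {v : ℝ} (hv : |v| ≤ 1) (i j x y : Fin n) :
    |score f v i j x y| ≤ 1 := by
  obtain ⟨h0, h1⟩ := share_mem_Icc hf i j
  have key : ∀ x : Fin n, |(if x = i then 1 else 0) - share f i j| ≤ 1 := fun x => by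
    rw [abs_le]
    split_ifs <;> constructor <;> linarith
  unfold score
  split_ifs
  · exact hv
  all_goals
    rw [abs_mul]
    refine mul_le_one₀ ?_ (abs_nonneg _) ?_
    · simpa [*] using key x
    · simpa [*] using key y

theorem expect_score (D : PMF (Fin n)) (v : ℝ) (i j : Fin n) :
    (expect (condSample D (insert i (block f i j)) (Finset.insert_nonempty _ _)) fun x =>
      expect (condSample D (insert i (block f i j)) (Finset.insert_nonempty _ _)) fun y =>
        score f v i j x y) = meanScore f D v i j := by
  unfold score meanScore
  split_ifs with h
  · simp [expect, ← Finset.sum_mul, sum_toReal_eq_one]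
  · exact expect_sub_mul_sub _ _ _

theorem meanScore_nonneg (D : PMF (Fin n)) {v : ℝ} (hv : 0 ≤ v) (i j : Fin n) :
    0 ≤ meanScore f D v i j := by
  unfold meanScore
  split_ifs
  · exact hv
  · positivity

/-- The number of outcomes, minus one, of the coin that simulates the weights `w`. -/
noncomputable def coinSize [Nonempty (Fin n)] (w : Fin n → ℝ) (hw : ∀ i, 0 ≤ w i) : ℕ :=
  (exists_sampler w hw).choose

/-- The element that an outcome of the coin stands for. -/
noncomputable def coinValue [Nonempty (Fin n)] (w : Fin n → ℝ) (hw : ∀ i, 0 ≤ w i) :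
    Fin (coinSize w hw + 1) → Fin n := (exists_sampler w hw).choose_spec.choose

theorem sum_mul_le_expect_coin [Nonempty (Fin n)] (w : Fin n → ℝ) (hw : ∀ i, 0 ≤ w i)
    (F : Fin n → ℝ) (hF : ∀ i, 0 ≤ F i) :
    ∑ i, w i * F i ≤ 2 * (∑ i, w i) *
      expect (PMF.uniformOfFintype (Fin (coinSize w hw + 1))) fun c => F (coinValue w hw c) := by
  rw [expect_uniformOfFintype, Fintype.card_fin, Nat.cast_succ]
  exact (exists_sampler w hw).choose_spec.choose_spec F hF

variable (f) in
/-- The weights `f` restricted to `lightSet f i`. -/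
noncomputable def lightWeight (i j : Fin n) : ℝ := if j ∈ lightSet f i then f j else 0

theorem lightWeight_nonneg (hf : ∀ i, 0 ≤ f i) (i j : Fin n) : 0 ≤ lightWeight f i j := by
  unfold lightWeight
  split_ifs
  exacts [hf j, le_rfl]

variable (f) in
/-- Sample twice from `insert i (block f i j)` and continue with the score. -/
noncomputable def compare {t : ℕ} (v : ℝ) (i j : Fin n) (next : ℝ → CondAlgorithm n t) :
    CondAlgorithm n (t + 2) :=
  .query (insert i (block f i j)) (Finset.insert_nonempty _ _) fun x =>
    .query (insert i (block f i j)) (Finset.insert_nonempty _ _) fun y => next (score f v i j x y)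

/-- One round: draw `i` from `f` with coins and `j` from the unknown distribution conditioned on
`lightSet f i`, or `i` from the unknown distribution and `j` from `f` conditioned on `lightSet f i`
with coins. Then compare. -/
noncomputable def round [Nonempty (Fin n)] (hf : ∀ i, 0 ≤ f i) {t : ℕ}
    (next : ℝ → CondAlgorithm n t) : CondAlgorithm n (t + 3) :=
  .toss 1 fun b =>
    if b = 0 then
      .toss (coinSize f hf) fun c =>
        .query (lightSet f (coinValue f hf c)) (lightSet_nonempty f _) fun j =>
          compare f 0 (coinValue f hf c) j next
    else
      .query Finset.univ Finset.univ_nonempty fun i =>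
        .toss (coinSize _ (lightWeight_nonneg hf i)) fun c =>
          compare f 1 i (coinValue _ (lightWeight_nonneg hf i) c) next

/-- The mean of the score when `i` is drawn with coins. -/
noncomputable def coinMean [Nonempty (Fin n)] (hf : ∀ i, 0 ≤ f i) (D : PMF (Fin n)) : ℝ :=
  expect (PMF.uniformOfFintype (Fin (coinSize f hf + 1))) fun c =>
    expect (condSample D (lightSet f (coinValue f hf c)) (lightSet_nonempty f _)) fun j =>
      meanScore f D 0 (coinValue f hf c) j

/-- The mean of the score when `i` is drawn from the oracle. -/
noncomputable def oracleMean [Nonempty (Fin n)] (hf : ∀ i, 0 ≤ f i) (D : PMF (Fin n)) : ℝ :=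
  expect (condSample D Finset.univ Finset.univ_nonempty) fun i =>
    expect (PMF.uniformOfFintype (Fin (coinSize _ (lightWeight_nonneg hf i) + 1))) fun c =>
      meanScore f D 1 i (coinValue _ (lightWeight_nonneg hf i) c)

/-- The mean of the score of a round. -/
noncomputable def roundMean [Nonempty (Fin n)] (hf : ∀ i, 0 ≤ f i) (D : PMF (Fin n)) : ℝ :=
  (coinMean hf D + oracleMean hf D) / 2

theorem compare_output_le (hf : ∀ i, 0 ≤ f i) (D : PMF (Fin n)) (r : Bool) {t : ℕ}
    {v : ℝ} (hv : |v| ≤ 1)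
    (i j : Fin n) {next : ℝ → CondAlgorithm n t} {a b : ℝ}
    (h : ∀ z, |z| ≤ 1 → ((next z).output D r).toReal ≤ a + b * z) :
    ((compare f v i j next).output D r).toReal ≤ a + b * meanScore f D v i j := by
  rw [← expect_score]
  simp only [compare, CondAlgorithm.output, toReal_bind_apply]
  exact expect_le_affine _ fun x => expect_le_affine _ fun y => h _ (abs_score_le_one hf hv i j x y)

theorem round_output_le [Nonempty (Fin n)] (hf : ∀ i, 0 ≤ f i) (D : PMF (Fin n)) (r : Bool)
    {t : ℕ} {next : ℝ → CondAlgorithm n t} {a b : ℝ}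
    (h : ∀ z, |z| ≤ 1 → ((next z).output D r).toReal ≤ a + b * z) :
    ((round hf next).output D r).toReal ≤ a + b * roundMean hf D := by
  have h0 : ((CondAlgorithm.toss (coinSize f hf) fun c =>
        .query (lightSet f (coinValue f hf c)) (lightSet_nonempty f _) fun j =>
          compare f 0 (coinValue f hf c) j next).output D r).toReal ≤ a + b * coinMean hf D := by
    simp only [CondAlgorithm.output, toReal_bind_apply]
    exact expect_le_affine _ fun c => expect_le_affine _ fun j =>
      compare_output_le hf D r (by simp) _ _ h
  have h1 : ((CondAlgorithm.query Finset.univ Finset.univ_nonempty fun i =>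
        .toss (coinSize _ (lightWeight_nonneg hf i)) fun c =>
          compare f 1 i (coinValue _ (lightWeight_nonneg hf i) c) next).output D r).toReal ≤
      a + b * oracleMean hf D := by
    simp only [CondAlgorithm.output, toReal_bind_apply]
    exact expect_le_affine _ fun c => expect_le_affine _ fun j =>
      compare_output_le hf D r (by simp) _ _ h
  rw [round, CondAlgorithm.output, toReal_bind_apply, expect_uniformOfFintype, Fin.sum_univ_two,
    if_pos rfl, if_neg (by decide), roundMean]
  simp only [Fintype.card_fin]
  push_cast
  linarith

open Classical in
/-- Add up the scores of `N` rounds, starting with `s`, and accept if the total is at most `θ`. -/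
noncomputable def run [Nonempty (Fin n)] (hf : ∀ i, 0 ≤ f i) (θ : ℝ) :
    (N : ℕ) → ℝ → CondAlgorithm n (3 * N)
  | 0, s => .answer (decide (s ≤ θ))
  | N + 1, s => round hf fun z => run hf θ N (s + z)

theorem run_output_le [Nonempty (Fin n)] (hf : ∀ i, 0 ≤ f i) (D : PMF (Fin n)) (r : Bool)
    {l κ : ℝ} (hl : |l| ≤ 1) (hr : if r then l ≤ 0 else 0 ≤ l) (hκ : l * roundMean hf D ≤ κ)
    (θ : ℝ) (N : ℕ) :
    ∀ s, ((run hf θ N s).output D r).toReal ≤ Real.exp (l * (s - θ) + N * (l ^ 2 + κ)) := by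
  induction N with
  | zero =>
    intro s
    simp only [run, CondAlgorithm.output, PMF.pure_apply, Nat.cast_zero, zero_mul, add_zero]
    split_ifs with h
    · rw [ENNReal.toReal_one, Real.one_le_exp_iff]
      cases r with
      | true =>
        have : s ≤ θ := by simpa using h
        exact mul_nonneg_of_nonpos_of_nonpos (by simpa using hr) (by linarith)
      | false =>
        have : θ < s := by simpa using h
        exact mul_nonneg (by simpa using hr) (by linarith)
    · rw [ENNReal.toReal_zero]
      exact (Real.exp_pos _).le
  | succ N ih =>
    intro s
    set K := Real.exp (l * (s - θ) + N * (l ^ 2 + κ)) with hK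
    have hK0 : 0 < K := Real.exp_pos _
    have hz : ∀ z, |z| ≤ 1 → ((run hf θ N (s + z)).output D r).toReal ≤
        K * (1 + l ^ 2) + K * l * z := by
      intro z hz
      refine (ih (s + z)).trans ?_
      have hlz : |l * z| ≤ 1 := by
        rw [abs_mul]
        exact mul_le_one₀ hl (abs_nonneg _) hz
      have hexp := (abs_le.1 (Real.abs_exp_sub_one_sub_id_le hlz)).2
      have hz2 : (l * z) ^ 2 ≤ l ^ 2 := by
        rw [mul_pow]
        exact mul_le_of_le_one_right (sq_nonneg _) ((sq_le_one_iff_abs_le_one _).2 hz)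
      have : Real.exp (l * (s + z - θ) + N * (l ^ 2 + κ)) = K * Real.exp (l * z) := by
        rw [hK, ← Real.exp_add]
        ring_nf
      rw [this]
      calc K * Real.exp (l * z) ≤ K * (1 + l ^ 2 + l * z) :=
            mul_le_mul_of_nonneg_left (by linarith) hK0.le
        _ = _ := by ring
    refine (round_output_le hf D r hz).trans ?_
    calc K * (1 + l ^ 2) + K * l * roundMean hf D
        = K * (l ^ 2 + l * roundMean hf D + 1) := by ring
      _ ≤ K * Real.exp (l ^ 2 + κ) :=
          mul_le_mul_of_nonneg_left ((by linarith : _ ≤ l ^ 2 + κ + 1).trans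
            (Real.add_one_le_exp _)) hK0.le
      _ = _ := by
          rw [hK, ← Real.exp_add]
          push_cast
          ring_nf

end IdentityTester

namespace IdentityTester

variable {n : ℕ}

theorem color_spec {f : Fin n → ℝ} (hf : ∀ i, 0 ≤ f i) {i : Fin n} (hi : 0 < f i) :
    ∀ j ∈ lightSet f i, f i ≤ ∑ k ∈ block f i j, f k ∧ ∑ k ∈ block f i j, f k ≤ 3 * f i :=
  Classical.epsilon_spec (exists_coloring_sum_mem_Icc f hi (lightSet f i)
    (fun _ hj => le_of_mem_lightSet hj)
    (Finset.single_le_sum (fun k _ => hf k) (self_mem_lightSet f i)))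

theorem meanScore_self (μ : PMF (Fin n)) (v : ℝ) {i : Fin n} (hi : (μ i).toReal ≠ 0)
    (j : Fin n) : meanScore (fun i => (μ i).toReal) μ v i j = 0 := by
  have hpos : 0 < ∑ k ∈ insert i (block (fun i => (μ i).toReal) i j), (μ k).toReal :=
    (ENNReal.toReal_nonneg.lt_of_ne' hi).trans_le
      (Finset.single_le_sum (f := fun k => (μ k).toReal) (fun k _ => ENNReal.toReal_nonneg)
        (Finset.mem_insert_self _ _))
  unfold meanScore share
  rw [if_neg hi, condSample_apply_toReal μ _ hpos (Finset.mem_insert_self _ _)]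
  simp

theorem condSample_univ_toReal [Nonempty (Fin n)] (D : PMF (Fin n)) (i : Fin n) :
    (condSample D Finset.univ Finset.univ_nonempty i).toReal = (D i).toReal := by
  rw [condSample_apply_toReal D _ (by rw [sum_toReal_eq_one]; exact one_pos) (Finset.mem_univ _),
    sum_toReal_eq_one, div_one]

/-- The scores have mean zero if the unknown distribution is the known one. -/
theorem roundMean_self [Nonempty (Fin n)] (μ : PMF (Fin n)) :
    roundMean (f := fun i => (μ i).toReal) (fun _ => ENNReal.toReal_nonneg) μ = 0 := by
  have h0 : ∀ i j, meanScore (fun i => (μ i).toReal) μ 0 i j = 0 := fun i j => by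
    by_cases hi : (μ i).toReal = 0
    · simp only [meanScore, hi, if_true]
    · exact meanScore_self μ 0 hi j
  have h1 : coinMean (f := fun i => (μ i).toReal) (fun _ => ENNReal.toReal_nonneg) μ = 0 := by
    simp [coinMean, h0, expect]
  have h2 : oracleMean (f := fun i => (μ i).toReal) (fun _ => ENNReal.toReal_nonneg) μ = 0 := by
    rw [oracleMean, expect]
    refine Finset.sum_eq_zero fun i _ => ?_
    rw [condSample_univ_toReal]
    by_cases hi : (μ i).toReal = 0
    · rw [hi, zero_mul]
    · simp [expect, meanScore_self μ 1 hi]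
  rw [roundMean, h1, h2]
  simp

theorem div_sixteen_le_sub {a t a' t' m m' η : ℝ} (ha : 0 < a) (hat : a ≤ t) (hta : t ≤ 3 * a)
    (ha' : 0 ≤ a') (ht' : 0 < t') (hη : 0 ≤ η)
    (h : a' * t ≤ (1 - η / 2) * (a * t')) (hm : m = t ∧ m' = t' ∨ m = a + t ∧ m' = a' + t') :
    η / 16 ≤ a / m - a' / m' := by
  have ht : 0 < t := ha.trans_le hat
  rcases hm with ⟨rfl, rfl⟩ | ⟨rfl, rfl⟩
  · have h1 : a' / m' ≤ (1 - η / 2) * (a / m) := by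
      rw [div_le_iff₀ ht', ← mul_le_mul_iff_left₀ ht]
      calc a' * m ≤ _ := h
        _ = _ := by field_simp
    have h2 : 1 / 3 ≤ a / m := by
      rw [div_le_div_iff₀ (by norm_num) ht]
      linarith
    nlinarith
  · rw [div_sub_div _ _ (by positivity) (by positivity), le_div_iff₀ (by positivity)]
    have h1 : η / 2 * (a * t') ≤ a * (a' + t') - (a + t) * a' := by linarith
    refine le_trans ?_ h1
    have h2 : a' * t ≤ a * t' := h.trans (mul_le_of_le_one_left (by positivity) (by linarith))
    have h3 : (a + t) * (a' + t') ≤ 8 * (a * t') := by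
      have : a * a' ≤ t * a' := mul_le_mul_of_nonneg_right hat ha'
      have : t * t' ≤ 3 * a * t' := mul_le_mul_of_nonneg_right hta ht'.le
      have : 0 < a * t' := by positivity
      linarith
    nlinarith

theorem div_sixteen_le_sub' {a t a' t' m m' η : ℝ} (ha : 0 < a) (hat : a ≤ t) (hta : t ≤ 3 * a)
    (ha' : 0 < a') (ht' : 0 ≤ t') (hη : 0 ≤ η)
    (h : a * t' ≤ (1 - η / 2) * (a' * t))
    (hm : m = t ∧ m' = t' ∧ a' ≤ t' ∨ m = a + t ∧ m' = a' + t') :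
    η / 16 ≤ a' / m' - a / m := by
  have ht : 0 < t := ha.trans_le hat
  rcases hm with ⟨rfl, rfl, h0⟩ | ⟨rfl, rfl⟩
  · have hm' : 0 < m' := ha'.trans_le h0
    have h1 : a / m ≤ (1 - η / 2) * (a' / m') := by
      rw [div_le_iff₀ ht, ← mul_le_mul_iff_left₀ hm']
      calc a * m' ≤ _ := h
        _ = _ := by field_simp
    have h2 : 1 / 3 ≤ a / m := by
      rw [div_le_div_iff₀ (by norm_num) ht]
      linarith
    have h3 : 0 < a' / m' := by positivity
    have h4 : 1 / 3 ≤ a' / m' := by nlinarith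
    nlinarith
  · rw [div_sub_div _ _ (by positivity) (by positivity), le_div_iff₀ (by positivity)]
    have h1 : η / 2 * (a' * t) ≤ a' * (a + t) - (a' + t') * a := by linarith
    refine le_trans ?_ h1
    have h2 : a * t' ≤ a' * t := h.trans (mul_le_of_le_one_left (by positivity) (by linarith))
    have h3 : (a' + t') * (a + t) ≤ 8 * (a' * t) := by
      have : a' * a ≤ a' * t := mul_le_mul_of_nonneg_left hat ha'.le
      have : t * t' ≤ 3 * a * t' := mul_le_mul_of_nonneg_right hta ht'
      have : 0 < a' * t := by positivity
      linarith
    nlinarith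

variable {f : Fin n → ℝ}

theorem sum_insert_block (g : Fin n → ℝ) (i j : Fin n) :
    (∑ k ∈ insert i (block f i j), f k = ∑ k ∈ block f i j, f k ∧
      ∑ k ∈ insert i (block f i j), g k = ∑ k ∈ block f i j, g k ∧ i ∈ block f i j) ∨
    (∑ k ∈ insert i (block f i j), f k = f i + ∑ k ∈ block f i j, f k ∧
      ∑ k ∈ insert i (block f i j), g k = g i + ∑ k ∈ block f i j, g k) := by
  by_cases h : i ∈ block f i j
  · exact Or.inl (by simp [Finset.insert_eq_of_mem h, h])
  · exact Or.inr (by simp [Finset.sum_insert h])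

theorem sq_le_meanScore (hf : ∀ i, 0 ≤ f i) (D : PMF (Fin n)) (v : ℝ) {i j : Fin n}
    (hi : 0 < f i) (hj : j ∈ lightSet f i) {η : ℝ} (hη : 0 ≤ η)
    (ht : 0 < ∑ k ∈ block f i j, (D k).toReal)
    (h : (D i).toReal * ∑ k ∈ block f i j, f k ≤
      (1 - η / 2) * (f i * ∑ k ∈ block f i j, (D k).toReal)) :
    (η / 16) ^ 2 ≤ meanScore f D v i j := by
  obtain ⟨h1, h2⟩ := color_spec hf hi j hj
  have hs := sum_insert_block (f := f) (fun k => (D k).toReal) i j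
  have hpos : 0 < ∑ k ∈ insert i (block f i j), (D k).toReal :=
    ht.trans_le (Finset.sum_le_sum_of_subset_of_nonneg (Finset.subset_insert _ _)
      fun _ _ _ => ENNReal.toReal_nonneg)
  rw [meanScore, if_neg hi.ne', condSample_apply_toReal D _ hpos (Finset.mem_insert_self _ _),
    share, sub_sq_comm]
  refine pow_le_pow_left₀ (by positivity) (div_sixteen_le_sub hi h1 h2 ENNReal.toReal_nonneg ht hη h
    ?_) 2
  rcases hs with h | h
  · exact Or.inl ⟨h.1, h.2.1⟩
  · exact Or.inr h

theorem sq_le_meanScore' (hf : ∀ i, 0 ≤ f i) (D : PMF (Fin n)) (v : ℝ) {i j : Fin n}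
    (hi : 0 < f i) (hj : j ∈ lightSet f i) {η : ℝ} (hη : 0 ≤ η) (hi' : 0 < (D i).toReal)
    (h : f i * ∑ k ∈ block f i j, (D k).toReal ≤
      (1 - η / 2) * ((D i).toReal * ∑ k ∈ block f i j, f k)) :
    (η / 16) ^ 2 ≤ meanScore f D v i j := by
  obtain ⟨h1, h2⟩ := color_spec hf hi j hj
  have hs := sum_insert_block (f := f) (fun k => (D k).toReal) i j
  have hpos : 0 < ∑ k ∈ insert i (block f i j), (D k).toReal :=
    hi'.trans_le (Finset.single_le_sum (f := fun k => (D k).toReal)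
      (fun _ _ => ENNReal.toReal_nonneg) (Finset.mem_insert_self _ _))
  rw [meanScore, if_neg hi.ne', condSample_apply_toReal D _ hpos (Finset.mem_insert_self _ _),
    share]
  refine pow_le_pow_left₀ (by positivity) (div_sixteen_le_sub' hi h1 h2 hi'
    (Finset.sum_nonneg fun _ _ => ENNReal.toReal_nonneg) hη h ?_) 2
  rcases hs with h | h
  · exact Or.inl ⟨h.1, h.2.1, Finset.single_le_sum (f := fun k => (D k).toReal)
      (fun _ _ => ENNReal.toReal_nonneg) h.2.2⟩
  · exact Or.inr h

/-- If `a / a'` is too small compared with `m / m'` and `t / t'` is not, then `a / a'` is too small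
compared with `t / t'`. -/
theorem mul_le_mul_of_ratio {a a' t t' m m' η : ℝ} (ha' : 0 ≤ a') (hm' : 0 < m')
    (hη0 : 0 ≤ η) (hη : η ≤ 1) (h : a * m' ≤ (1 - η) * (a' * m))
    (hT : (1 - η / 2) * m * t' ≤ t * m') (ht' : 0 ≤ t') (hm : 0 ≤ m) :
    a * t' ≤ (1 - η / 2) * (a' * t) := by
  rw [← mul_le_mul_iff_left₀ hm']
  calc a * t' * m' = a * m' * t' := by ring
    _ ≤ (1 - η) * (a' * m) * t' := mul_le_mul_of_nonneg_right h ht'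
    _ ≤ (1 - η / 2) ^ 2 * (a' * m) * t' := by
        have : (1 - η) ≤ (1 - η / 2) ^ 2 := by nlinarith
        gcongr
    _ = (1 - η / 2) * a' * ((1 - η / 2) * m * t') := by ring
    _ ≤ (1 - η / 2) * a' * (t * m') :=
        mul_le_mul_of_nonneg_left hT (mul_nonneg (by linarith) ha')
    _ = _ := by ring

/-- A mean over `lightSet f i` of a nonnegative function that is at least `c` on the good blocks. -/
theorem mul_le_sum_of_good_blocks {u w : Fin n → ℝ} (hu : ∀ k, 0 ≤ u k) (hw : ∀ k, 0 ≤ w k)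
    {i : Fin n} (hpos : 0 < ∑ k ∈ lightSet f i, w k) {η c : ℝ} (hη : η ≤ 1)
    (F : Fin n → ℝ) (hF : ∀ j, 0 ≤ F j)
    (h : ∀ j ∈ lightSet f i, (1 - η / 2) * (∑ k ∈ lightSet f i, u k) * (∑ k ∈ block f i j, w k) ≤
      (∑ k ∈ block f i j, u k) * ∑ k ∈ lightSet f i, w k → c ≤ F j) (hc : 0 ≤ c) :
    η / 2 * (∑ k ∈ lightSet f i, u k) * c ≤ ∑ j ∈ lightSet f i, u j * F j := by
  have := mul_sum_le_sum_filter_color u w hu hw (lightSet f i) (color f i) (θ := η / 2)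
    (by linarith) hpos
  refine (mul_le_mul_of_nonneg_right this hc).trans ?_
  rw [Finset.sum_mul]
  refine (Finset.sum_le_sum fun j hj => ?_).trans
    (Finset.sum_le_sum_of_subset_of_nonneg (Finset.filter_subset _ _)
      fun j _ _ => mul_nonneg (hu j) (hF j))
  obtain ⟨hj, hg⟩ := Finset.mem_filter.1 hj
  exact mul_le_mul_of_nonneg_left (h j hj hg) (hu j)

theorem le_coinMean_term (hf : ∀ i, 0 ≤ f i) (D : PMF (Fin n)) {η : ℝ} (hη0 : 0 ≤ η) (hη : η ≤ 1)
    {i : Fin n} (hi : 0 < f i) (hD : 0 < ∑ k ∈ lightSet f i, (D k).toReal)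
    (h : (D i).toReal * ∑ k ∈ lightSet f i, f k ≤
      (1 - η) * (f i * ∑ k ∈ lightSet f i, (D k).toReal)) :
    η / 2 * (η / 16) ^ 2 ≤
      expect (condSample D (lightSet f i) (lightSet_nonempty f _)) fun j =>
        meanScore f D 0 i j := by
  have hG : 0 < ∑ k ∈ lightSet f i, f k :=
    hi.trans_le (Finset.single_le_sum (fun k _ => hf k) (self_mem_lightSet f i))
  have hD0 : ∀ k, 0 ≤ (D k).toReal := fun _ => ENNReal.toReal_nonneg
  have key := mul_le_sum_of_good_blocks (f := f) hD0 hf hG hη (c := (η / 16) ^ 2)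
    (fun j => meanScore f D 0 i j) (meanScore_nonneg D le_rfl i) ?_ (by positivity)
  · rw [mul_right_comm, ← le_div_iff₀ hD, Finset.sum_div] at key
    refine key.trans ?_
    refine (Finset.sum_le_sum fun j hj => ?_).trans
      (Finset.sum_le_sum_of_subset_of_nonneg (Finset.subset_univ (lightSet f i)) fun j _ _ =>
        mul_nonneg ENNReal.toReal_nonneg (meanScore_nonneg D le_rfl i j))
    rw [condSample_apply_toReal D _ hD hj, div_mul_eq_mul_div]
  · intro j hj hgood
    obtain ⟨h1, -⟩ := color_spec hf hi j hj
    have hbf : 0 < ∑ k ∈ block f i j, f k := hi.trans_le h1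
    have hb : 0 < ∑ k ∈ block f i j, (D k).toReal := by
      refine (mul_pos_iff_of_pos_right hG).1 (lt_of_lt_of_le ?_ hgood)
      have : 0 < 1 - η / 2 := by linarith
      positivity
    exact sq_le_meanScore hf D 0 hi hj hη0 hb
      (mul_le_mul_of_ratio hi.le hG hη0 hη h hgood hbf.le hD.le)

theorem le_oracleMean_term [Nonempty (Fin n)] (hf : ∀ i, 0 ≤ f i) (D : PMF (Fin n)) {η : ℝ}
    (hη0 : 0 ≤ η) (hη : η ≤ 1) {i : Fin n} (hi : 0 < (D i).toReal)
    (h : f i * ∑ k ∈ lightSet f i, (D k).toReal ≤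
      (1 - η) * ((D i).toReal * ∑ k ∈ lightSet f i, f k)) :
    η / 4 * (η / 16) ^ 2 ≤
      expect (PMF.uniformOfFintype (Fin (coinSize _ (lightWeight_nonneg hf i) + 1))) fun c =>
        meanScore f D 1 i (coinValue _ (lightWeight_nonneg hf i) c) := by
  rcases (hf i).eq_or_lt with h0 | h0
  · have : ∀ j, meanScore f D 1 i j = 1 := fun j => if_pos h0.symm
    simp only [this, expect, mul_one, sum_toReal_eq_one]
    calc η / 4 * (η / 16) ^ 2 ≤ 1 / 4 * (1 / 16) ^ 2 := by gcongr
      _ ≤ 1 := by norm_num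
  have hG : 0 < ∑ k ∈ lightSet f i, f k :=
    h0.trans_le (Finset.single_le_sum (fun k _ => hf k) (self_mem_lightSet f i))
  have hD0 : ∀ k, 0 ≤ (D k).toReal := fun _ => ENNReal.toReal_nonneg
  have hD : 0 < ∑ k ∈ lightSet f i, (D k).toReal :=
    hi.trans_le (Finset.single_le_sum (fun k _ => hD0 k) (self_mem_lightSet f i))
  have key := mul_le_sum_of_good_blocks (f := f) hf hD0 hD hη (c := (η / 16) ^ 2)
    (fun j => meanScore f D 1 i j) (meanScore_nonneg D zero_le_one i) ?_ (by positivity)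
  · have hcoin := sum_mul_le_expect_coin _ (lightWeight_nonneg hf i)
      (fun j => meanScore f D 1 i j) (meanScore_nonneg D zero_le_one i)
    simp only [lightWeight, ite_mul, zero_mul, Finset.sum_ite_mem, Finset.univ_inter] at hcoin
    have h2 := key.trans hcoin
    rw [← mul_le_mul_iff_left₀ hG]
    linarith
  · intro j hj hgood
    exact sq_le_meanScore' hf D 1 h0 hj hη0 hi
      (mul_le_mul_of_ratio hi.le hD hη0 hη h hgood
        (Finset.sum_nonneg fun k _ => hD0 k) hG.le)

/-- The scores have a noticeable mean if the unknown distribution is far from the known one. -/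
theorem le_roundMean [Nonempty (Fin n)] (hf : ∀ i, 0 ≤ f i) (hf1 : ∑ i, f i = 1)
    (D : PMF (Fin n)) {ε η : ℝ} (hη0 : 0 ≤ η) (hη : η ≤ 1)
    (hfar : ε ≤ 1 / 2 * ∑ i, |f i - (D i).toReal|) :
    (ε - 2 * η) * (η / 8 * (η / 16) ^ 2) ≤ roundMean hf D := by
  have hD0 : ∀ k, 0 ≤ (D k).toReal := fun _ => ENNReal.toReal_nonneg
  have hdiff := le_sum_hazard_differs f (fun i => (D i).toReal) hf hD0 hf1 (sum_toReal_eq_one D)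
    hη0 hfar
  set x := η / 8 * (η / 16) ^ 2 with hx
  have hx0 : 0 ≤ x := by positivity
  have hcoin : (∑ i, if 0 < ∑ j ∈ lightSet f i, (D j).toReal ∧
        (D i).toReal * ∑ j ∈ lightSet f i, f j ≤
          (1 - η) * (f i * ∑ j ∈ lightSet f i, (D j).toReal) then f i else 0) * x ≤
      coinMean hf D / 2 := by
    have h := sum_mul_le_expect_coin f hf
      (fun i => expect (condSample D (lightSet f i) (lightSet_nonempty f _)) fun j =>
        meanScore f D 0 i j) (fun i => expect_nonneg _ (meanScore_nonneg D le_rfl i))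
    rw [hf1, mul_one] at h
    change _ ≤ 2 * coinMean hf D at h
    suffices (∑ i, if 0 < ∑ j ∈ lightSet f i, (D j).toReal ∧
        (D i).toReal * ∑ j ∈ lightSet f i, f j ≤
          (1 - η) * (f i * ∑ j ∈ lightSet f i, (D j).toReal) then f i else 0) * (4 * x) ≤ _ by
      linarith [this.trans h]
    rw [Finset.sum_mul]
    refine Finset.sum_le_sum fun i _ => ?_
    have hnn := expect_nonneg (condSample D (lightSet f i) (lightSet_nonempty f _))
      (meanScore_nonneg (f := f) D le_rfl i)
    split_ifs with hi
    · rcases (hf i).eq_or_lt with h0 | h0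
      · simp [← h0]
      · refine mul_le_mul_of_nonneg_left ?_ (hf i)
        refine le_trans (le_of_eq ?_) (le_coinMean_term hf D hη0 hη h0 hi.1 hi.2)
        rw [hx]
        ring
    · rw [zero_mul]
      exact mul_nonneg (hf i) hnn
  have horacle : (∑ i, if f i * ∑ j ∈ lightSet f i, (D j).toReal ≤
        (1 - η) * ((D i).toReal * ∑ j ∈ lightSet f i, f j) then (D i).toReal else 0) * x ≤
      oracleMean hf D / 2 := by
    rw [oracleMean, expect, Finset.sum_mul, Finset.sum_div]
    refine Finset.sum_le_sum fun i _ => ?_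
    rw [condSample_univ_toReal, mul_div_assoc]
    have hnn := expect_nonneg
      (PMF.uniformOfFintype (Fin (coinSize _ (lightWeight_nonneg hf i) + 1)))
      (fun c => meanScore_nonneg (f := f) D zero_le_one i
        (coinValue _ (lightWeight_nonneg hf i) c))
    split_ifs with hi
    · rcases (hD0 i).eq_or_lt with h0 | h0
      · simp [← h0]
      · refine mul_le_mul_of_nonneg_left ?_ (hD0 i)
        have := le_oracleMean_term hf D hη0 hη h0 hi
        rw [hx]
        linarith
    · rw [zero_mul]
      exact mul_nonneg (hD0 i) (by linarith)
  have h3 := mul_le_mul_of_nonneg_right hdiff hx0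
  rw [add_mul] at h3
  rw [roundMean]
  linarith

end IdentityTester

namespace IdentityTester

/-- A lower bound for the mean of the score of a round at distance `ε`. -/
noncomputable def gap (ε : ℝ) : ℝ := (min ε 1) ^ 4 / 2 ^ 18

/-- The number of rounds for distance `ε` and error bound `δ`. -/
noncomputable def rounds (ε δ : ℝ) : ℕ := ⌈16 * Real.log δ⁻¹ / gap ε ^ 2⌉₊

theorem gap_pos {ε : ℝ} (hε : 0 < ε) : 0 < gap ε := by
  have : 0 < min ε 1 := lt_min hε one_pos
  unfold gap
  positivity

theorem gap_le_one {ε : ℝ} (hε : 0 < ε) : gap ε ≤ 1 := by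
  have h0 : 0 ≤ min ε 1 := (lt_min hε one_pos).le
  have := pow_le_one₀ (n := 4) h0 (min_le_right ε 1)
  unfold gap
  linarith

theorem exp_rounds_le {ε δ : ℝ} (hε : 0 < ε) (hδ : 0 < δ) :
    Real.exp (-(rounds ε δ * (gap ε ^ 2 / 16))) ≤ δ := by
  have hg := gap_pos hε
  have h : 16 * Real.log δ⁻¹ / gap ε ^ 2 ≤ rounds ε δ := Nat.le_ceil _
  rw [div_le_iff₀ (by positivity), Real.log_inv] at h
  calc Real.exp (-(rounds ε δ * (gap ε ^ 2 / 16))) ≤ Real.exp (Real.log δ) :=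
        Real.exp_le_exp.2 (by linarith)
    _ = δ := Real.exp_log hδ

/-- The tester of identity with `μ`. -/
noncomputable def tester (ε δ : ℝ) (n : ℕ) (μ : PMF (Fin n)) :
    CondAlgorithm n (3 * rounds ε δ) :=
  haveI : Nonempty (Fin n) := ⟨μ.support_nonempty.some⟩
  run (f := fun i => (μ i).toReal) (fun _ => ENNReal.toReal_nonneg) (rounds ε δ * (gap ε / 2))
    (rounds ε δ) 0

theorem one_sub_le_toReal_apply (p : PMF Bool) {r : Bool} {δ : ℝ} (h : (p (!r)).toReal ≤ δ) :
    1 - δ ≤ (p r).toReal := by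
  have := sum_toReal_eq_one p
  rw [Fintype.sum_bool] at this
  cases r <;> simp only [Bool.not_true, Bool.not_false] at h <;> linarith

theorem tester_tests {ε δ : ℝ} (hε : 0 < ε) (hδ : 0 < δ) {n : ℕ} (μ : PMF (Fin n)) :
    (tester ε δ n μ).Tests {μ} ε δ := by
  have : Nonempty (Fin n) := ⟨μ.support_nonempty.some⟩
  have hg := gap_pos hε
  have hg1 := gap_le_one hε
  have hf : ∀ i, 0 ≤ (μ i).toReal := fun _ => ENNReal.toReal_nonneg
  constructor
  · rintro D rfl
    refine one_sub_le_toReal_apply _ (le_trans ?_ (exp_rounds_le hε hδ))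
    refine (run_output_le hf D false (l := gap ε / 4) (κ := 0) ?_ ?_ ?_ _ _ 0).trans
      (Real.exp_le_exp.2 (le_of_eq ?_))
    · rw [abs_of_nonneg (by positivity)]
      linarith
    · simp only [Bool.false_eq_true, if_false]
      positivity
    · rw [roundMean_self, mul_zero]
    · ring
  · intro D hD
    have hfar : min ε 1 ≤ 1 / 2 * ∑ i, |(μ i).toReal - (D i).toReal| := by
      refine (min_le_left _ _).trans ((hD μ rfl).trans (le_of_eq ?_))
      unfold variationDist
      simp only [abs_sub_comm]
    have h0 : 0 < min ε 1 := lt_min hε one_pos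
    have h1 : min ε 1 ≤ 1 := min_le_right _ _
    have hmean : gap ε ≤ roundMean hf D := by
      refine le_trans (le_of_eq ?_) (le_roundMean hf (sum_toReal_eq_one μ) D
        (η := min ε 1 / 4) (by positivity) (by linarith) hfar)
      unfold gap
      ring
    refine one_sub_le_toReal_apply _ (le_trans ?_ (exp_rounds_le hε hδ))
    refine (run_output_le hf D true (l := -(gap ε / 4)) (κ := -(gap ε ^ 2 / 4)) ?_ ?_ ?_ _ _
      0).trans (Real.exp_le_exp.2 (le_of_eq ?_))
    · rw [abs_neg, abs_of_nonneg (by positivity)]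
      linarith
    · simp only [if_true]
      linarith
    · nlinarith
    · ring

theorem rounds_le {ε δ : ℝ} (hε : 0 < ε) (hδ : 0 < δ) (hδ1 : δ < 1) :
    (rounds ε δ : ℝ) ≤ 2 ^ 40 * (1 + ε⁻¹) ^ 8 * Real.logb 2 δ⁻¹ + 1 := by
  have hlog : 0 ≤ Real.log δ⁻¹ := Real.log_nonneg (one_le_inv_iff₀.2 ⟨hδ, hδ1.le⟩)
  have hlogb : Real.log δ⁻¹ ≤ Real.logb 2 δ⁻¹ := by
    rw [Real.logb, le_div_iff₀ (Real.log_pos one_lt_two)]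
    exact mul_le_of_le_one_right hlog (by linarith [Real.log_two_lt_d9])
  have h0 : 0 < min ε 1 := lt_min hε one_pos
  have hinv : (min ε 1)⁻¹ ≤ 1 + ε⁻¹ := by
    have : 0 < ε⁻¹ := inv_pos.2 hε
    rcases min_choice ε 1 with h | h <;> rw [h]
    · linarith
    · rw [inv_one]
      linarith
  have hg := gap_pos hε
  refine (Nat.ceil_lt_add_one (by positivity)).le.trans (add_le_add_left ?_ 1)
  calc 16 * Real.log δ⁻¹ / gap ε ^ 2 = 2 ^ 40 * ((min ε 1)⁻¹) ^ 8 * Real.log δ⁻¹ := by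
        unfold gap
        field_simp
        ring
    _ ≤ _ := by gcongr

end IdentityTester

theorem mainTheorem6 :
    ∃ (t : ℝ → ℝ → ℕ → ℕ)
      (T : ∀ (ε δ : ℝ) (n : ℕ), PMF (Fin n) → CondAlgorithm n (t ε δ n)),
      (∀ (ε δ : ℝ) (n : ℕ) (μ : PMF (Fin n)), 0 < ε → 0 < δ →
        (T ε δ n μ).Tests {μ} ε δ) ∧
      ∃ P : MvPolynomial (Fin 3) ℝ, ∀ (ε δ : ℝ) (n : ℕ), 0 < ε → 0 < δ → δ < 1 →
        (t ε δ n : ℝ) ≤ MvPolynomial.eval ![(logStar n : ℝ), ε⁻¹, Real.logb 2 δ⁻¹] P := by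
  refine ⟨fun ε δ _ => 3 * IdentityTester.rounds ε δ, IdentityTester.tester,
    fun ε δ n μ hε hδ => IdentityTester.tester_tests hε hδ μ,
    3 * (MvPolynomial.C (2 ^ 40) * (1 + MvPolynomial.X 1) ^ 8 * MvPolynomial.X 2 + 1), ?_⟩
  intro ε δ n hε hδ hδ1
  have h := IdentityTester.rounds_le hε hδ hδ1
  simp only [map_mul, map_add, map_pow, map_one, map_ofNat, MvPolynomial.eval_X,
    Matrix.cons_val_one, Matrix.cons_val, Matrix.cons_val_zero]
  push_cast
  linarith
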